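/- **Setting.** Let $\Lambda$ be an integrally closed domain, $L=\operatorname{Frac}\Lambda$, $G$ a finite subgroup of $\operatorname{Aut}(\Lambda)$ and $\mathscr M$ a submonoid of $\operatorname{Aut}(\Lambda)$ such that $\mathscr M\mathscr M^{-1}\cap G=1$, $g\mathscr M g^{-1}\subseteq\mathscr M$ for all $g\in G$, and $\Lambda$ is a Noetherian $\Lambda^G$-module. Let $\mathscr L=L\#\mathscr M$ be the skew monoid ring, with $(a\mu)(b\nu)=a\,\mu(b)\,\mu\nu$. The group $G$ acts on it by $g(a\mu)=g(a)\,g\mu g^{-1}$. Put $\Gamma=\Lambda^G$, $K=L^G$, $\mathscr K=\mathscr L^G$. A *Galois $\Gamma$-ring* is a subring $\mathscr U\subseteq\mathscr K$ containing $\Gamma$, generated as a ring by $\Gamma$ and finitely many elements, with $K\mathscr U=\mathscr UK=\mathscr K$. It is a *Galois $\Gamma$-order* if for every finite-dimensional left (respectively right) $K$-subspace $W\subseteq\mathscr K$, $W\cap\mathscr U$ is a finitely generated left (respectively right) $\Gamma$-module. **The algebra $A(\mathfrak{gl}_n)$.** Let $\Lambda=\mathbb C[x_{ki}\mid 1\le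 i\le k\le n]$ and $G=\mathbb A_n=A_1\times\cdots\times A_n$, where the alternating group $A_k$ permutes $x_{k1},\dots,x_{kk}$. Let $\mathscr M$ be the group generated by the automorphisms $\delta^{ki}$, $1\le i\le k\le n-1$, where $\delta^{ki}(x_{ki})=x_{ki}-1$ and $\delta^{ki}$ fixes the other variables. Put $\widetilde\Gamma=\Lambda^{\mathbb A_n}$. Then $A(\mathfrak{gl}_n)$ is the $\mathbb C$-subalgebra of $\mathscr L$ generated by $$X_k^{\pm}=\sum_{i=1}^k(\delta^{ki})^{\pm1}a_{ki}^{\pm}\ (1\le k\le n-1),\qquad X_{kk}=\sum_{j=1}^k(x_{kj}+j-1)-\sum_{i=1}^{k-1}(x_{k-1,i}+i-1)\ (1\le k\le n),$$ $$\mathcal V_k=\prod_{1\le i<j\le k}(x_{ki}-x_{kj})\ (2\le k\le n),\qquad\text{where } a_{ki}^{\pm}=\mp\frac{\prod_{j=1}^{k\pm1}(x_{k\pm1,j}-x_{ki})}{\prod_{j\ne i}(x_{kj}-x_{ki})}.$$ **Theorem.** For $n=2$, the triple $(\Lambda,\mathbb A_2,\mathscr M)$ satisfies the assumptions above and $A(\mathfrak{gl}_2)$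 is a Galois $\widetilde\Gamma$-order. Moreover, $\widetilde\Gamma$ is a Harish-Chandra subalgebra of $A(\mathfrak{gl}_2)$ (it is commutative and, for every $u\in A(\mathfrak{gl}_2)$, $\widetilde\Gamma u\widetilde\Gamma$ is finitely generated as a left and as a right $\widetilde\Gamma$-module), and $\widetilde\Gamma$ is a maximal commutative subalgebra of $A(\mathfrak{gl}_2)$. -/

import Mathlib

noncomputable section

namespace GaloisOrders

/-! ### Galois rings and Galois orders

`Λ` is a domain, `G` a (finite) subgroup of `Aut Λ` and `M` a submonoid of `Aut Λ`. -/

section General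

variable {Λ : Type*} [CommRing Λ] [IsDomain Λ]

/-- Automorphisms of a domain act on its field of fractions `L = Frac Λ`. -/
instance autActionFrac (Λ : Type*) [CommRing Λ] [IsDomain Λ] :
    MulSemiringAction (RingAut Λ) (FractionRing Λ) :=
  IsFractionRing.mulSemiringAction (RingAut Λ) Λ (FractionRing Λ)

/-- The skew monoid ring `𝓛 = L # M`: the free left `L`-module on `M` with multiplication
`(a μ) (b ν) = (a * μ(b)) (μ ν)`. The element `a μ` is `SkewMonoidAlgebra.single μ a`. -/
abbrev SkewRing (M : Submonoid (RingAut Λ)) : Type _ :=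
  SkewMonoidAlgebra (FractionRing Λ) M

/-- The embedding `L → 𝓛`, `a ↦ a e`, with `e` the unit of `M`. -/
def ofFrac (M : Submonoid (RingAut Λ)) : FractionRing Λ →+* SkewRing M :=
  SkewMonoidAlgebra.singleOneRingHom

/-- The embedding `Λ → 𝓛`. -/
def ofDomain (M : Submonoid (RingAut Λ)) : Λ →+* SkewRing M :=
  (ofFrac M).comp (algebraMap Λ (FractionRing Λ))

/-- The standing assumptions on `(Λ, G, M)`. -/
structure Assumptions (G : Subgroup (RingAut Λ)) (M : Submonoid (RingAut Λ)) : Prop where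
  integrallyClosed : IsIntegrallyClosed Λ
  finite : Finite G
  /-- `(M M⁻¹) ∩ G = 1` -/
  separation : ∀ μ ∈ M, ∀ ν ∈ M, μ * ν⁻¹ ∈ G → μ * ν⁻¹ = 1
  /-- `G` normalizes `M` -/
  invariance : ∀ g ∈ G, ∀ μ ∈ M, g * μ * g⁻¹ ∈ M
  /-- `Λ` is Noetherian as a module over `Λ^G` -/
  finiteness : IsNoetherian (FixedPoints.subring Λ G) Λ

/-- `Γ = Λ^G`, as a subring of `𝓛`. -/
def Gam (G : Subgroup (RingAut Λ)) (M : Submonoid (RingAut Λ)) : Subring (SkewRing M) :=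
  (FixedPoints.subring Λ G).map (ofDomain M)

/-- `K = L^G`, as a subring of `𝓛`. -/
def FixedField (G : Subgroup (RingAut Λ)) (M : Submonoid (RingAut Λ)) : Subring (SkewRing M) :=
  (FixedPoints.subring (FractionRing Λ) G).map (ofFrac M)

/-- `𝓚 = 𝓛^G`. The action of `g ∈ G` on `𝓛` is `a μ ↦ g(a) (g μ g⁻¹)`, so that `X` is invariant
exactly when, for all `g ∈ G` and `μ ∈ M`, its coefficient at `ν = g μ g⁻¹` is `g` applied to its
coefficient at `μ`. -/
def Invariants (G : Subgroup (RingAut Λ)) (M : Submonoid (RingAut Λ)) : Set (SkewRing M) :=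
  {X | ∀ g ∈ G, ∀ μ ν : M, (ν : RingAut Λ) = g * (μ : RingAut Λ) * g⁻¹ →
    X.coeff ν = g • X.coeff μ}

/- In a ring `R` with a subring `B`, left `B`-modules are `Submodule B R`, and right `B`-modules are
`Submodule B.op R`, where `op b` acts by `r ↦ r * b`. -/

/-- `U` is a Galois `Γ`-ring: a subring of `𝓚` containing `Γ`, generated as a ring by `Γ` and
finitely many elements, with `K U = U K = 𝓚`. -/
structure IsGaloisRing (G : Subgroup (RingAut Λ)) (M : Submonoid (RingAut Λ))
    (U : Subring (SkewRing M)) : Prop where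
  assumptions : Assumptions G M
  base_le : Gam G M ≤ U
  le_invariants : (U : Set (SkewRing M)) ⊆ Invariants G M
  finitelyGenerated : ∃ S : Finset (SkewRing M),
    U = Subring.closure ((Gam G M : Set (SkewRing M)) ∪ (S : Set (SkewRing M)))
  left_span : (Submodule.span (FixedField G M) (U : Set (SkewRing M)) : Set (SkewRing M))
    = Invariants G M
  right_span : (Submodule.span (FixedField G M).op (U : Set (SkewRing M)) : Set (SkewRing M))
    = Invariants G M

/-- `U` is a left Galois `Γ`-order: for every finite-dimensional left `K`-subspace `W` of `𝓚`, the
left `Γ`-module `W ∩ U` is finitely generated. -/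
def IsLeftGaloisOrder (G : Subgroup (RingAut Λ)) (M : Submonoid (RingAut Λ))
    (U : Subring (SkewRing M)) : Prop :=
  IsGaloisRing G M U ∧
  ∀ W : Submodule (FixedField G M) (SkewRing M),
    (W : Set (SkewRing M)) ⊆ Invariants G M → W.FG →
    ∃ S : Finset (SkewRing M),
      (Submodule.span (Gam G M) (S : Set (SkewRing M)) : Set (SkewRing M)) =
        (W : Set (SkewRing M)) ∩ (U : Set (SkewRing M))

/-- `U` is a right Galois `Γ`-order. -/
def IsRightGaloisOrder (G : Subgroup (RingAut Λ)) (M : Submonoid (RingAut Λ))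
    (U : Subring (SkewRing M)) : Prop :=
  IsGaloisRing G M U ∧
  ∀ W : Submodule (FixedField G M).op (SkewRing M),
    (W : Set (SkewRing M)) ⊆ Invariants G M → W.FG →
    ∃ S : Finset (SkewRing M),
      (Submodule.span (Gam G M).op (S : Set (SkewRing M)) : Set (SkewRing M)) =
        (W : Set (SkewRing M)) ∩ (U : Set (SkewRing M))

/-- `U` is a Galois `Γ`-order. -/
def IsGaloisOrder (G : Subgroup (RingAut Λ)) (M : Submonoid (RingAut Λ))
    (U : Subring (SkewRing M)) : Prop :=
  IsLeftGaloisOrder G M U ∧ IsRightGaloisOrder G M U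

end General

section Subrings

variable {R : Type*} [Ring R]

/-- The additive group `B u B` generated by the products `b * u * c` with `b, c ∈ B`. -/
def doubleSpan (B : Subring R) (u : R) : AddSubgroup R :=
  AddSubgroup.closure {r | ∃ b ∈ B, ∃ c ∈ B, r = b * u * c}

/-- `B` is a Harish-Chandra subalgebra of `U`: it is commutative and, for every `u ∈ U`, `B u B` is
finitely generated as a left and as a right `B`-module. -/
def IsHarishChandra (B U : Subring R) : Prop :=
  B ≤ U ∧ (∀ b ∈ B, ∀ c ∈ B, b * c = c * b) ∧
  ∀ u ∈ U,
    (∃ S : Finset R, (Submodule.span B (S : Set R) : Set R) = (doubleSpan B u : Set R)) ∧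
    (∃ S : Finset R, (Submodule.span B.op (S : Set R) : Set R) = (doubleSpan B u : Set R))

/-- `B` is maximal among the commutative subrings of `U`. -/
def IsMaximalCommutative (B U : Subring R) : Prop :=
  Maximal (fun C : Subring R => C ≤ U ∧ ∀ b ∈ C, ∀ c ∈ C, b * c = c * b) B

end Subrings

/-! ### The algebra `A(gl_n)` -/

/-- Indices of the variables `x_{ki}`, `1 ≤ i ≤ k ≤ n`. The pair `(k, i)` is stored as
`(k - 1, i - 1)`. -/
abbrev Idx (n : ℕ) : Type := Σ k : Fin n, Fin (k.1 + 1)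

/-- `Λ = ℂ[x_{ki} | 1 ≤ i ≤ k ≤ n]`. -/
abbrev Lam (n : ℕ) : Type := MvPolynomial (Idx n) ℂ

/-- The variable `x_{ki}`; it is only used for `1 ≤ i ≤ k ≤ n`. -/
def x (n k i : ℕ) : Lam n :=
  if h : 1 ≤ i ∧ i ≤ k ∧ k ≤ n then
    MvPolynomial.X (⟨⟨k - 1, by omega⟩, ⟨i - 1, by simp only; omega⟩⟩ : Idx n)
  else 0

/-- Permutations of the variables as automorphisms of `Λ`. -/
def permAut (n : ℕ) : Equiv.Perm (Idx n) →* RingAut (Lam n) where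
  toFun σ := (MvPolynomial.renameEquiv ℂ σ).toRingEquiv
  map_one' := by
    ext p
    simp
  map_mul' σ τ := by
    ext p
    simp [MvPolynomial.rename_rename, Equiv.Perm.coe_mul]

/-- `𝔸_n = A_1 × A_2 × ⋯ × A_n`, where `A_k` permutes `x_{k1}, …, x_{kk}`. -/
def altProd (n : ℕ) : Subgroup (RingAut (Lam n)) :=
  (Subgroup.pi Set.univ fun k : Fin n => alternatingGroup (Fin (k.1 + 1))).map
    ((permAut n).comp (Equiv.Perm.sigmaCongrRightHom fun k : Fin n => Fin (k.1 + 1)))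

/-- The translation `x_p ↦ x_p - v_p`. -/
def translation (n : ℕ) (v : Idx n → ℂ) : RingAut (Lam n) :=
  (AlgEquiv.ofAlgHom
    (MvPolynomial.aeval fun p => MvPolynomial.X p - MvPolynomial.C (v p) : Lam n →ₐ[ℂ] Lam n)
    (MvPolynomial.aeval fun p => MvPolynomial.X p + MvPolynomial.C (v p) : Lam n →ₐ[ℂ] Lam n)
    (by ext p : 1; simp)
    (by ext p : 1; simp)).toRingEquiv

/-- `δ^{ki}`, which sends `x_{ki}` to `x_{ki} - 1` and fixes the other variables. -/
def delta (n k i : ℕ) : RingAut (Lam n) :=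
  translation n fun p => if p.1.1 + 1 = k ∧ p.2.1 + 1 = i then 1 else 0

/-- The group generated by the `δ^{ki}`, `1 ≤ i ≤ k ≤ n - 1`. -/
def shiftGroup (n : ℕ) : Subgroup (RingAut (Lam n)) :=
  Subgroup.closure {d | ∃ k i : ℕ, 1 ≤ i ∧ i ≤ k ∧ k < n ∧ d = delta n k i}

/-- The same group, as a submonoid of `Aut Λ`. -/
abbrev shifts (n : ℕ) : Submonoid (RingAut (Lam n)) := (shiftGroup n).toSubmonoid

theorem delta_mem (n : ℕ) {k : ℕ} (hk : k < n) (i : Fin k) :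
    delta n k (i.1 + 1) ∈ shiftGroup n :=
  Subgroup.subset_closure ⟨k, i.1 + 1, by omega, by omega, hk, rfl⟩

/-- `δ^{k,i+1}` as an element of `shifts n`. -/
def deltaPos (n : ℕ) {k : ℕ} (hk : k < n) (i : Fin k) : shifts n :=
  ⟨delta n k (i.1 + 1), delta_mem n hk i⟩

/-- `(δ^{k,i+1})⁻¹` as an element of `shifts n`. -/
def deltaNeg (n : ℕ) {k : ℕ} (hk : k < n) (i : Fin k) : shifts n :=
  ⟨(delta n k (i.1 + 1))⁻¹, (shiftGroup n).inv_mem (delta_mem n hk i)⟩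

/-- The variable `x_{ki}` in `L`. -/
def xL (n k i : ℕ) : FractionRing (Lam n) := algebraMap (Lam n) (FractionRing (Lam n)) (x n k i)

/-- `a_{ki}^+ = - ∏_{j=1}^{k+1} (x_{k+1,j} - x_{ki}) / ∏_{j ≠ i} (x_{kj} - x_{ki})` -/
def aPos (n k i : ℕ) : FractionRing (Lam n) :=
  -((∏ j ∈ Finset.Icc 1 (k + 1), (xL n (k + 1) j - xL n k i)) /
    ∏ j ∈ (Finset.Icc 1 k).erase i, (xL n k j - xL n k i))

/-- `a_{ki}^- = ∏_{j=1}^{k-1} (x_{k-1,j} - x_{ki}) / ∏_{j ≠ i} (x_{kj} - x_{ki})` -/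
def aNeg (n k i : ℕ) : FractionRing (Lam n) :=
  (∏ j ∈ Finset.Icc 1 (k - 1), (xL n (k - 1) j - xL n k i)) /
    ∏ j ∈ (Finset.Icc 1 k).erase i, (xL n k j - xL n k i)

/-- `X_k^+ = ∑_{i=1}^k δ^{ki} a_{ki}^+` -/
def XPos (n : ℕ) {k : ℕ} (hk : k < n) : SkewRing (shifts n) :=
  ∑ i : Fin k, SkewMonoidAlgebra.single (deltaPos n hk i) 1 * ofFrac (shifts n) (aPos n k (i.1 + 1))

/-- `X_k^- = ∑_{i=1}^k (δ^{ki})⁻¹ a_{ki}^-` -/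
def XNeg (n : ℕ) {k : ℕ} (hk : k < n) : SkewRing (shifts n) :=
  ∑ i : Fin k, SkewMonoidAlgebra.single (deltaNeg n hk i) 1 * ofFrac (shifts n) (aNeg n k (i.1 + 1))

/-- `X_{kk} = ∑_{j=1}^k (x_{kj} + j - 1) - ∑_{i=1}^{k-1} (x_{k-1,i} + i - 1)` -/
def XDiag (n k : ℕ) : Lam n :=
  ∑ j ∈ Finset.Icc 1 k, (x n k j + (j : Lam n) - 1) -
    ∑ i ∈ Finset.Icc 1 (k - 1), (x n (k - 1) i + (i : Lam n) - 1)

/-- The Vandermonde polynomial `𝒱_k = ∏_{1 ≤ i < j ≤ k} (x_{ki} - x_{kj})`. -/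
def vandermonde (n k : ℕ) : Lam n :=
  ∏ i ∈ Finset.Icc 1 k, ∏ j ∈ Finset.Ioc i k, (x n k i - x n k j)

/-- `U_n`, the image of `U(gl_n)` in `𝓛`: the `ℂ`-subalgebra generated by `X_k^±` (`1 ≤ k < n`) and
`X_{kk}` (`1 ≤ k ≤ n`), the images of `E_{k,k+1}`, `E_{k+1,k}` and `E_{kk}`. -/
def Un (n : ℕ) : Subring (SkewRing (shifts n)) :=
  Subring.closure
    (Set.range (fun c : ℂ => ofDomain (shifts n) (MvPolynomial.C c)) ∪
      {X | ∃ (k : ℕ) (_ : 1 ≤ k) (hk : k < n), X = XPos n hk ∨ X = XNeg n hk} ∪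
      {X | ∃ k : ℕ, 1 ≤ k ∧ k ≤ n ∧ X = ofDomain (shifts n) (XDiag n k)})

/-- `A(gl_n)`: the subalgebra of `𝓛` generated by `U_n` and `𝒱_2, …, 𝒱_n`. -/
def Agl (n : ℕ) : Subring (SkewRing (shifts n)) :=
  Subring.closure
    ((Un n : Set (SkewRing (shifts n))) ∪
      {X | ∃ k : ℕ, 2 ≤ k ∧ k ≤ n ∧ X = ofDomain (shifts n) (vandermonde n k)})

/-- `Γ̃ = Λ^{𝔸_n}`, as a subring of `𝓛`. -/
abbrev GamTilde (n : ℕ) : Subring (SkewRing (shifts n)) := Gam (altProd n) (shifts n)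

end GaloisOrders

end

/-!
For `n = 2` everything has coefficients in `Λ`. The groups `A_1` and `A_2` are trivial, so
`𝔸_2 = 1`, `Γ̃ = Λ = ℂ[x_11, x_21, x_22]` and `𝓚 = 𝓛`, while `M` is generated by `δ = δ^{11}`. The
denominators of `a_11^±` are empty products, so `X_1^- = δ⁻¹` and
`X_1^+ = -δ (x_21 - x_11)(x_22 - x_11)` lie in the skew ring `Λ # M` (`integralSubring`). The
elements `X_11`, `X_22` and `𝒱_2` generate `Λ` over `ℂ` because `2` is invertible
(`ofDomain_mem_Agl_two`). Hence `A(gl_2)` is generated over `Λ` by `X_1^±`, is contained in `Λ # M`,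
and contains a nonzero multiple of each `μ ∈ M`; the last property gives `L U = U L = 𝓛`
(`left_span_eq_univ`, `right_span_eq_univ`).

The remaining claims hold for subrings `U` with `Γ ≤ U ≤ Λ # M`. The elements of a
finite-dimensional `W ⊆ 𝓚`, and those of `Γ u Γ`, have their supports in one finite set `T ⊆ M`, so
that `W ∩ U` and `Γ u Γ` are submodules of `⨁_{μ ∈ T} Λ μ = ⨁_{μ ∈ T} μ Λ`. This is a Noetherian
`Γ`-module on both sides, since `Λ` is one (`left_fg_of_support_subset`,
`right_fg_of_support_subset`). For maximal commutativity, an element that commutes with all `a ∈ Λ`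
has coefficients `c_μ` with `c_μ (μ(a) - a) = 0`, so it is supported at `μ = 1`
(`isMaximalCommutative_Gam_bot`).
-/

noncomputable section

namespace GaloisOrders

/-! ### The skew ring `Λ # M` with integral coefficients -/

section General

variable {Λ : Type*} [CommRing Λ] [IsDomain Λ]

theorem smul_algebraMap_frac (g : RingAut Λ) (a : Λ) :
    g • algebraMap Λ (FractionRing Λ) a = algebraMap Λ (FractionRing Λ) (g a) :=
  IsFractionRing.ringEquivOfRingEquiv_algebraMap _ _

variable {G : Subgroup (RingAut Λ)} {M : Submonoid (RingAut Λ)}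

theorem ofFrac_apply (a : FractionRing Λ) : ofFrac M a = SkewMonoidAlgebra.single 1 a := rfl

theorem ofDomain_apply (a : Λ) :
    ofDomain M a = SkewMonoidAlgebra.single 1 (algebraMap Λ (FractionRing Λ) a) := rfl

theorem coeff_ofFrac_mul (a : FractionRing Λ) (X : SkewRing M) (μ : M) :
    (ofFrac M a * X).coeff μ = a * X.coeff μ := by
  exact SkewMonoidAlgebra.coeff_single_one_mul X a μ

theorem coeff_mul_ofFrac (a : FractionRing Λ) (X : SkewRing M) (μ : M) :
    (X * ofFrac M a).coeff μ = X.coeff μ * (μ : RingAut Λ) • a :=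
  SkewMonoidAlgebra.coeff_mul_single_one X a μ

theorem coeff_ofDomain_mul (a : Λ) (X : SkewRing M) (μ : M) :
    (ofDomain M a * X).coeff μ = algebraMap Λ (FractionRing Λ) a * X.coeff μ :=
  coeff_ofFrac_mul _ X μ

theorem coeff_mul_ofDomain (a : Λ) (X : SkewRing M) (μ : M) :
    (X * ofDomain M a).coeff μ = X.coeff μ * algebraMap Λ (FractionRing Λ) ((μ : RingAut Λ) a) := by
  rw [← smul_algebraMap_frac]
  exact coeff_mul_ofFrac _ X μ

/-- Taking the coefficient at `μ`, as an additive map. -/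
def coeffHom (μ : M) : SkewRing M →+ FractionRing Λ where
  toFun X := X.coeff μ
  map_zero' := rfl
  map_add' X Y := by simp

omit [IsDomain Λ] in
theorem coeffHom_apply (μ : M) (X : SkewRing M) : coeffHom μ X = X.coeff μ := rfl

variable (M) in
/-- The skew monoid ring `Λ # M` with coefficients in `Λ`, as a subring of `L # M`. -/
def integralSubring : Subring (SkewRing M) where
  carrier := {X | ∀ μ, X.coeff μ ∈ (algebraMap Λ (FractionRing Λ)).range}
  zero_mem' μ := zero_mem _
  one_mem' μ := by
    classical
    rw [SkewMonoidAlgebra.one_def, SkewMonoidAlgebra.coeff_single_apply]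
    split_ifs
    exacts [one_mem _, zero_mem _]
  add_mem' hX hY μ := by
    rw [SkewMonoidAlgebra.coeff_add]
    exact add_mem (hX μ) (hY μ)
  neg_mem' hX μ := by
    rw [SkewMonoidAlgebra.coeff_neg]
    exact neg_mem (hX μ)
  mul_mem' {X Y} hX hY μ := by
    classical
    rw [SkewMonoidAlgebra.mul_def, ← coeffHom_apply, SkewMonoidAlgebra.sum_def', map_sum]
    refine sum_mem fun ν _ => ?_
    rw [SkewMonoidAlgebra.sum_def', map_sum]
    refine sum_mem fun ρ _ => ?_
    rw [coeffHom_apply, SkewMonoidAlgebra.coeff_single_apply]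
    split_ifs
    · obtain ⟨b, hb⟩ := hY ρ
      refine mul_mem (hX ν) ⟨(ν : RingAut Λ) b, ?_⟩
      rw [← smul_algebraMap_frac, hb]
      rfl
    · exact zero_mem _

theorem mem_integralSubring {X : SkewRing M} :
    X ∈ integralSubring M ↔ ∀ μ, ∃ a, algebraMap Λ (FractionRing Λ) a = X.coeff μ :=
  Iff.rfl

theorem single_mem_integralSubring (μ : M) (a : Λ) :
    SkewMonoidAlgebra.single μ (algebraMap Λ (FractionRing Λ) a) ∈ integralSubring M := by
  classical
  intro ν
  rw [SkewMonoidAlgebra.coeff_single_apply]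
  split_ifs
  exacts [⟨a, rfl⟩, zero_mem _]

theorem ofDomain_mem_integralSubring (a : Λ) : ofDomain M a ∈ integralSubring M :=
  single_mem_integralSubring 1 a

theorem ofDomain_mem_Gam {c : Λ} (hc : c ∈ FixedPoints.subring Λ G) : ofDomain M c ∈ Gam G M :=
  ⟨c, hc, rfl⟩

theorem Gam_le_FixedField : Gam G M ≤ FixedField G M := by
  rintro _ ⟨c, hc, rfl⟩
  refine ⟨algebraMap Λ _ c, fun g => ?_, rfl⟩
  have h : (g : RingAut Λ) c = c := hc g
  have := smul_algebraMap_frac (g : RingAut Λ) c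
  rw [h] at this
  exact this

theorem Gam_mul_comm {b c : SkewRing M} (hb : b ∈ Gam G M) (hc : c ∈ Gam G M) :
    b * c = c * b := by
  obtain ⟨b, -, rfl⟩ := hb
  obtain ⟨c, -, rfl⟩ := hc
  rw [← map_mul, ← map_mul, mul_comm]

/-- The isomorphism `Λ^G → Γ` onto its copy in `𝓛`. -/
def toGam (G : Subgroup (RingAut Λ)) (M : Submonoid (RingAut Λ)) :
    FixedPoints.subring Λ G →+* Gam G M where
  toFun c := ⟨ofDomain M c, ofDomain_mem_Gam c.2⟩
  map_one' := Subtype.ext (map_one _)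
  map_mul' _ _ := Subtype.ext (map_mul (ofDomain M) _ _)
  map_zero' := Subtype.ext (map_zero _)
  map_add' _ _ := Subtype.ext (map_add (ofDomain M) _ _)

/-- The isomorphism `Λ^G → Γᵒᵖ`; it is multiplicative since `Λ` is commutative. -/
def toGamOp (G : Subgroup (RingAut Λ)) (M : Submonoid (RingAut Λ)) :
    FixedPoints.subring Λ G →+* (Gam G M).op where
  toFun c := ⟨MulOpposite.op (ofDomain M c), ofDomain_mem_Gam c.2⟩
  map_one' := Subtype.ext (congrArg MulOpposite.op (map_one (ofDomain M)))
  map_mul' a b := Subtype.ext (congrArg MulOpposite.op (by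
    rw [mul_comm]
    exact map_mul (ofDomain M) _ _))
  map_zero' := Subtype.ext (congrArg MulOpposite.op (map_zero (ofDomain M)))
  map_add' _ _ := Subtype.ext (congrArg MulOpposite.op (map_add (ofDomain M) _ _))

instance : RingHomSurjective (toGam G M) :=
  ⟨by
    rintro ⟨_, c, hc, rfl⟩
    exact ⟨⟨c, hc⟩, rfl⟩⟩

instance : RingHomSurjective (toGamOp G M) :=
  ⟨by
    rintro ⟨b, c, hc, h⟩
    exact ⟨⟨c, hc⟩, Subtype.ext (congrArg MulOpposite.op h)⟩⟩

/-! ### Finite generation, Galois orders and Harish-Chandra subalgebras -/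

/-- The map `Λ^T → 𝓛`, `(a_μ) ↦ ∑ a_μ μ`, for a finite `T ⊆ M`, as a map of left modules. -/
def leftComb (G : Subgroup (RingAut Λ)) (M : Submonoid (RingAut Λ)) (T : Finset M) :
    (T → Λ) →ₛₗ[toGam G M] SkewRing M where
  toFun v := ∑ μ : T, SkewMonoidAlgebra.single μ.1 (algebraMap Λ (FractionRing Λ) (v μ))
  map_add' v w := by simp [Finset.sum_add_distrib, SkewMonoidAlgebra.single_add]
  map_smul' c v := by
    change _ = ofDomain M c * _
    rw [Finset.mul_sum]
    refine Finset.sum_congr rfl fun μ _ => ?_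
    rw [ofDomain_apply, SkewMonoidAlgebra.single_mul_single, one_mul, one_smul, ← map_mul]
    rfl

/-- The map `Λ^T → 𝓛`, `(a_μ) ↦ ∑ μ a_μ = ∑ μ(a_μ) μ`, for a finite `T ⊆ M`, as a map of right
modules. -/
def rightComb (G : Subgroup (RingAut Λ)) (M : Submonoid (RingAut Λ)) (T : Finset M) :
    (T → Λ) →ₛₗ[toGamOp G M] SkewRing M where
  toFun v := ∑ μ : T, SkewMonoidAlgebra.single μ.1
    (algebraMap Λ (FractionRing Λ) ((μ.1 : RingAut Λ) (v μ)))
  map_add' v w := by simp [Finset.sum_add_distrib, SkewMonoidAlgebra.single_add]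
  map_smul' c v := by
    change _ = _ * ofDomain M c
    rw [Finset.sum_mul]
    refine Finset.sum_congr rfl fun μ _ => ?_
    have h : μ.1 • algebraMap Λ (FractionRing Λ) c.1 =
        algebraMap Λ (FractionRing Λ) ((μ.1 : RingAut Λ) c.1) := smul_algebraMap_frac _ _
    rw [ofDomain_apply, SkewMonoidAlgebra.single_mul_single, mul_one, h, ← map_mul, ← map_mul,
      mul_comm]
    rfl

omit [IsDomain Λ] in
theorem eq_sum_single {T : Finset M} {X : SkewRing M} (hX : X.support ⊆ T) :
    X = ∑ μ : T, SkewMonoidAlgebra.single μ.1 (X.coeff μ) := by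
  classical
  rw [Finset.sum_coe_sort T fun μ => SkewMonoidAlgebra.single μ (X.coeff μ)]
  conv_lhs => rw [← SkewMonoidAlgebra.sum_single X]
  rw [SkewMonoidAlgebra.sum_def']
  refine Finset.sum_subset hX fun μ _ hμ => ?_
  rw [SkewMonoidAlgebra.notMem_support_iff.1 hμ, SkewMonoidAlgebra.single_zero]

/-- A left `Γ`-submodule of `Λ # M` whose elements are supported in one finite set is finitely
generated. -/
theorem left_fg_of_support_subset [IsNoetherian (FixedPoints.subring Λ G) Λ] (T : Finset M)
    (P : Submodule (Gam G M) (SkewRing M)) (hT : ∀ X ∈ P, X.support ⊆ T)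
    (hP : ∀ X ∈ P, X ∈ integralSubring M) : P.FG := by
  have hr : P ≤ LinearMap.range (leftComb G M T) := fun X hX => by
    choose a ha using mem_integralSubring.1 (hP X hX)
    refine ⟨fun μ => a μ, ?_⟩
    rw [eq_sum_single (hT X hX)]
    exact Finset.sum_congr rfl fun μ _ => by rw [ha]
  rw [← Submodule.map_comap_eq_self hr]
  exact (IsNoetherian.noetherian (P.comap (leftComb G M T))).map _

/-- A right `Γ`-submodule of `Λ # M` whose elements are supported in one finite set is finitely
generated. -/
theorem right_fg_of_support_subset [IsNoetherian (FixedPoints.subring Λ G) Λ] (T : Finset M)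
    (P : Submodule (Gam G M).op (SkewRing M)) (hT : ∀ X ∈ P, X.support ⊆ T)
    (hP : ∀ X ∈ P, X ∈ integralSubring M) : P.FG := by
  have hr : P ≤ LinearMap.range (rightComb G M T) := fun X hX => by
    choose a ha using mem_integralSubring.1 (hP X hX)
    refine ⟨fun μ => (μ.1 : RingAut Λ).symm (a μ), ?_⟩
    rw [eq_sum_single (hT X hX)]
    refine Finset.sum_congr rfl fun μ _ => ?_
    rw [RingEquiv.apply_symm_apply, ha]
  rw [← Submodule.map_comap_eq_self hr]
  exact (IsNoetherian.noetherian (P.comap (rightComb G M T))).map _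

theorem support_ofFrac_mul_subset (a : FractionRing Λ) (X : SkewRing M) :
    (ofFrac M a * X).support ⊆ X.support := fun μ hμ => by
  rw [SkewMonoidAlgebra.mem_support_iff, coeff_ofFrac_mul] at hμ
  exact SkewMonoidAlgebra.mem_support_iff.2 (right_ne_zero_of_mul hμ)

theorem support_mul_ofFrac_subset (a : FractionRing Λ) (X : SkewRing M) :
    (X * ofFrac M a).support ⊆ X.support := fun μ hμ => by
  rw [SkewMonoidAlgebra.mem_support_iff, coeff_mul_ofFrac] at hμ
  exact SkewMonoidAlgebra.mem_support_iff.2 (left_ne_zero_of_mul hμ)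

omit [IsDomain Λ] in
theorem support_add_subset {T : Finset M} {X Y : SkewRing M} (hX : X.support ⊆ T)
    (hY : Y.support ⊆ T) : (X + Y).support ⊆ T := by
  classical
  exact SkewMonoidAlgebra.support_add.trans (Finset.union_subset hX hY)

/-- The elements of a finite-dimensional left `K`-subspace have a common finite support. -/
theorem exists_support_subset_of_left_fg {W : Submodule (FixedField G M) (SkewRing M)}
    (hW : W.FG) : ∃ T : Finset M, ∀ X ∈ W, X.support ⊆ T := by
  classical
  obtain ⟨S, rfl⟩ := hW
  refine ⟨S.biUnion fun X => X.support, fun X hX => ?_⟩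
  induction hX using Submodule.span_induction with
  | mem X hX => exact Finset.subset_biUnion_of_mem (fun X : SkewRing M => X.support) hX
  | zero => exact Finset.empty_subset _
  | add X Y _ _ hX hY => exact support_add_subset hX hY
  | smul a X _ hX =>
    obtain ⟨_, a, -, rfl⟩ := a
    exact (support_ofFrac_mul_subset a X).trans hX

/-- The elements of a finite-dimensional right `K`-subspace have a common finite support. -/
theorem exists_support_subset_of_right_fg {W : Submodule (FixedField G M).op (SkewRing M)}
    (hW : W.FG) : ∃ T : Finset M, ∀ X ∈ W, X.support ⊆ T := by
  classical
  obtain ⟨S, rfl⟩ := hW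
  refine ⟨S.biUnion fun X => X.support, fun X hX => ?_⟩
  induction hX using Submodule.span_induction with
  | mem X hX => exact Finset.subset_biUnion_of_mem (fun X : SkewRing M => X.support) hX
  | zero => exact Finset.empty_subset _
  | add X Y _ _ hX hY => exact support_add_subset hX hY
  | smul b X _ hX =>
    obtain ⟨b, a, -, hab⟩ := b
    have : X * b.unop = X * ofFrac M a := congrArg (X * ·) hab.symm
    change (X * b.unop).support ⊆ _
    rw [this]
    exact (support_mul_ofFrac_subset a X).trans hX

/-- A Galois ring contained in `Λ # M` is a left Galois order. -/
theorem IsGaloisRing.isLeftGaloisOrder {U : Subring (SkewRing M)} (h : IsGaloisRing G M U)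
    (hU : U ≤ integralSubring M) : IsLeftGaloisOrder G M U := by
  refine ⟨h, fun W _ hfg => ?_⟩
  have := h.assumptions.finiteness
  obtain ⟨T, hT⟩ := exists_support_subset_of_left_fg hfg
  let P : Submodule (Gam G M) (SkewRing M) :=
    { carrier := (W : Set (SkewRing M)) ∩ U
      add_mem' := fun hX hY => ⟨W.add_mem hX.1 hY.1, U.add_mem hX.2 hY.2⟩
      zero_mem' := ⟨W.zero_mem, U.zero_mem⟩
      smul_mem' := fun b _ hX =>
        ⟨W.smul_mem ⟨b, Gam_le_FixedField b.2⟩ hX.1, U.mul_mem (h.base_le b.2) hX.2⟩ }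
  obtain ⟨S, hS⟩ := left_fg_of_support_subset T P (fun X hX => hT X hX.1) fun X hX => hU hX.2
  exact ⟨S, congrArg (fun Q : Submodule (Gam G M) (SkewRing M) => (Q : Set (SkewRing M))) hS⟩

/-- A Galois ring contained in `Λ # M` is a right Galois order. -/
theorem IsGaloisRing.isRightGaloisOrder {U : Subring (SkewRing M)} (h : IsGaloisRing G M U)
    (hU : U ≤ integralSubring M) : IsRightGaloisOrder G M U := by
  refine ⟨h, fun W _ hfg => ?_⟩
  have := h.assumptions.finiteness
  obtain ⟨T, hT⟩ := exists_support_subset_of_right_fg hfg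
  let P : Submodule (Gam G M).op (SkewRing M) :=
    { carrier := (W : Set (SkewRing M)) ∩ U
      add_mem' := fun hX hY => ⟨W.add_mem hX.1 hY.1, U.add_mem hX.2 hY.2⟩
      zero_mem' := ⟨W.zero_mem, U.zero_mem⟩
      smul_mem' := fun b _ hX =>
        ⟨W.smul_mem ⟨b, Gam_le_FixedField b.2⟩ hX.1, U.mul_mem hX.2 (h.base_le b.2)⟩ }
  obtain ⟨S, hS⟩ := right_fg_of_support_subset T P (fun X hX => hT X hX.1) fun X hX => hU hX.2
  exact ⟨S, congrArg (fun Q : Submodule (Gam G M).op (SkewRing M) => (Q : Set (SkewRing M))) hS⟩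

theorem IsGaloisRing.isGaloisOrder {U : Subring (SkewRing M)} (h : IsGaloisRing G M U)
    (hU : U ≤ integralSubring M) : IsGaloisOrder G M U :=
  ⟨h.isLeftGaloisOrder hU, h.isRightGaloisOrder hU⟩

theorem mul_mem_doubleSpan {R : Type*} [Ring R] {B : Subring R} {u b r : R} (hb : b ∈ B)
    (hr : r ∈ doubleSpan B u) : b * r ∈ doubleSpan B u := by
  induction hr using AddSubgroup.closure_induction with
  | mem r hr =>
    obtain ⟨b', hb', c, hc, rfl⟩ := hr
    exact AddSubgroup.subset_closure ⟨b * b', mul_mem hb hb', c, hc, by simp only [mul_assoc]⟩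
  | zero => simp
  | add r s _ _ hr hs => simpa only [mul_add] using add_mem hr hs
  | neg r _ hr => simpa only [mul_neg] using neg_mem hr

theorem doubleSpan_mul_mem {R : Type*} [Ring R] {B : Subring R} {u b r : R} (hb : b ∈ B)
    (hr : r ∈ doubleSpan B u) : r * b ∈ doubleSpan B u := by
  induction hr using AddSubgroup.closure_induction with
  | mem r hr =>
    obtain ⟨b', hb', c, hc, rfl⟩ := hr
    exact AddSubgroup.subset_closure ⟨b', hb', c * b, mul_mem hc hb, by simp only [mul_assoc]⟩
  | zero => simp
  | add r s _ _ hr hs => simpa only [add_mul] using add_mem hr hs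
  | neg r _ hr => simpa only [neg_mul] using neg_mem hr

theorem support_subset_of_mem_doubleSpan {u X : SkewRing M} (hX : X ∈ doubleSpan (Gam G M) u) :
    X.support ⊆ u.support := by
  induction hX using AddSubgroup.closure_induction with
  | mem X hX =>
    obtain ⟨_, ⟨b, -, rfl⟩, _, ⟨c, -, rfl⟩, rfl⟩ := hX
    exact (support_mul_ofFrac_subset _ _).trans (support_ofFrac_mul_subset _ _)
  | zero => exact Finset.empty_subset _
  | add X Y _ _ hX hY => exact support_add_subset hX hY
  | neg X _ hX =>
    intro μ hμ
    refine hX ?_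
    simpa [SkewMonoidAlgebra.mem_support_iff] using hμ

/-- If `Λ` is a Noetherian `Γ`-module, then `Γ` is a Harish-Chandra subalgebra of every ring
between `Γ` and `Λ # M`: the elements of `Γ u Γ` are supported in the support of `u`. -/
theorem isHarishChandra_of_le_integralSubring [IsNoetherian (FixedPoints.subring Λ G) Λ]
    {U : Subring (SkewRing M)} (hG : Gam G M ≤ U) (hU : U ≤ integralSubring M) :
    IsHarishChandra (Gam G M) U := by
  refine ⟨hG, fun b hb c hc => Gam_mul_comm hb hc, fun u hu => ?_⟩
  have hint : ∀ X ∈ doubleSpan (Gam G M) u, X ∈ integralSubring M := by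
    intro X hX
    refine (AddSubgroup.closure_le (integralSubring M).toAddSubgroup).2 ?_ hX
    rintro _ ⟨b, hb, c, hc, rfl⟩
    change b * u * c ∈ integralSubring M
    exact mul_mem (mul_mem (hU (hG hb)) (hU hu)) (hU (hG hc))
  constructor
  · let P : Submodule (Gam G M) (SkewRing M) :=
      { doubleSpan (Gam G M) u with smul_mem' := fun b _ hX => mul_mem_doubleSpan b.2 hX }
    obtain ⟨S, hS⟩ := left_fg_of_support_subset u.support P
      (fun X hX => support_subset_of_mem_doubleSpan hX) hint
    exact ⟨S, congrArg (fun Q : Submodule (Gam G M) (SkewRing M) => (Q : Set (SkewRing M))) hS⟩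
  · let P : Submodule (Gam G M).op (SkewRing M) :=
      { doubleSpan (Gam G M) u with smul_mem' := fun b _ hX => doubleSpan_mul_mem b.2 hX }
    obtain ⟨S, hS⟩ := right_fg_of_support_subset u.support P
      (fun X hX => support_subset_of_mem_doubleSpan hX) hint
    exact ⟨S, congrArg (fun Q : Submodule (Gam G M).op (SkewRing M) => (Q : Set (SkewRing M))) hS⟩

/-! ### The case of the trivial group `G` -/

omit [IsDomain Λ] in
theorem mem_fixedPoints_bot (a : Λ) :
    a ∈ FixedPoints.subring Λ (⊥ : Subgroup (RingAut Λ)) := by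
  rintro ⟨g, hg⟩
  rw [Subgroup.mem_bot] at hg
  subst hg
  rfl

theorem ofDomain_mem_Gam_bot (a : Λ) : ofDomain M a ∈ Gam ⊥ M :=
  ofDomain_mem_Gam (mem_fixedPoints_bot a)

theorem ofFrac_mem_FixedField_bot (a : FractionRing Λ) : ofFrac M a ∈ FixedField ⊥ M := by
  refine ⟨a, ?_, rfl⟩
  rintro ⟨g, hg⟩
  rw [Subgroup.mem_bot] at hg
  subst hg
  exact one_smul (RingAut Λ) a

theorem invariants_bot : Invariants (⊥ : Subgroup (RingAut Λ)) M = Set.univ := by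
  refine Set.eq_univ_of_forall fun X g hg μ ν h => ?_
  rw [Subgroup.mem_bot] at hg
  subst hg
  obtain rfl : ν = μ := Subtype.ext (by simpa using h)
  rw [one_smul]

omit [IsDomain Λ] in
theorem assumptions_bot [IsIntegrallyClosed Λ] [IsNoetherianRing Λ] :
    Assumptions (⊥ : Subgroup (RingAut Λ)) M where
  integrallyClosed := inferInstance
  finite := inferInstance
  separation _ _ _ _ h := Subgroup.mem_bot.1 h
  invariance g hg μ hμ := by
    rw [Subgroup.mem_bot] at hg
    simpa [hg] using hμ
  finiteness := by
    -- over `Λ^1 = Λ`, submodules are ideals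
    refine ⟨fun N => ?_⟩
    let I : Ideal Λ :=
      { N with smul_mem' := fun a _ h => N.smul_mem ⟨a, mem_fixedPoints_bot a⟩ h }
    obtain ⟨S, hS⟩ := IsNoetherian.noetherian I
    refine ⟨S, le_antisymm (Submodule.span_le.2 fun s hs => ?_) fun y hy => ?_⟩
    · have : s ∈ I := hS ▸ Submodule.subset_span hs
      exact this
    · have hy' : y ∈ Submodule.span Λ (S : Set Λ) := hS ▸ hy
      induction hy' using Submodule.span_induction with
      | mem s hs => exact Submodule.subset_span hs
      | zero => exact zero_mem _
      | add a b ha hb iha ihb =>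
        rw [hS] at ha hb
        exact add_mem (iha ha) (ihb hb)
      | smul a b hb ih =>
        rw [hS] at hb
        exact Submodule.smul_mem _ (⟨a, mem_fixedPoints_bot a⟩ : FixedPoints.subring Λ _) (ih hb)

/-- If `U` contains a nonzero multiple of every `μ ∈ M`, then `L U = L # M`. -/
theorem left_span_eq_univ {U : Subring (SkewRing M)}
    (hU : ∀ μ : M, ∃ p ≠ 0, SkewMonoidAlgebra.single μ p ∈ U) :
    (Submodule.span (FixedField ⊥ M) (U : Set (SkewRing M)) : Set (SkewRing M)) = Set.univ := by
  refine Set.eq_univ_of_forall fun X => ?_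
  rw [SetLike.mem_coe, eq_sum_single (T := X.support) subset_rfl]
  refine sum_mem fun μ _ => ?_
  obtain ⟨p, hp, hmem⟩ := hU μ
  have := Submodule.smul_mem (Submodule.span (FixedField ⊥ M) (U : Set (SkewRing M)))
    ⟨ofFrac M (X.coeff μ * p⁻¹), ofFrac_mem_FixedField_bot _⟩ (Submodule.subset_span hmem)
  convert this using 1
  change _ = ofFrac M _ * _
  rw [ofFrac_apply, SkewMonoidAlgebra.single_mul_single, one_mul, one_smul,
    inv_mul_cancel_right₀ hp]

/-- If `U` contains a nonzero multiple of every `μ ∈ M`, then `U L = L # M`. -/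
theorem right_span_eq_univ {U : Subring (SkewRing M)}
    (hU : ∀ μ : M, ∃ p ≠ 0, SkewMonoidAlgebra.single μ p ∈ U) :
    (Submodule.span (FixedField ⊥ M).op (U : Set (SkewRing M)) : Set (SkewRing M)) =
      Set.univ := by
  refine Set.eq_univ_of_forall fun X => ?_
  rw [SetLike.mem_coe, eq_sum_single (T := X.support) subset_rfl]
  refine sum_mem fun μ _ => ?_
  obtain ⟨p, hp, hmem⟩ := hU μ
  -- `p μ · μ⁻¹(a / p) = a μ`
  have := Submodule.smul_mem (Submodule.span (FixedField ⊥ M).op (U : Set (SkewRing M)))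
    ⟨MulOpposite.op (ofFrac M ((μ.1 : RingAut Λ)⁻¹ • (p⁻¹ * X.coeff μ))),
      ofFrac_mem_FixedField_bot _⟩ (Submodule.subset_span hmem)
  convert this using 1
  change _ = _ * ofFrac M _
  have h : μ.1 • (μ.1 : RingAut Λ)⁻¹ • (p⁻¹ * X.coeff μ) = p⁻¹ * X.coeff μ :=
    smul_inv_smul (μ.1 : RingAut Λ) _
  rw [ofFrac_apply, SkewMonoidAlgebra.single_mul_single, mul_one, h, mul_inv_cancel_left₀ hp]

/-- `Λ` is its own centralizer in `Λ # M`, because `M` acts faithfully. -/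
theorem isMaximalCommutative_Gam_bot {U : Subring (SkewRing M)} (hG : Gam ⊥ M ≤ U)
    (hU : U ≤ integralSubring M) : IsMaximalCommutative (Gam ⊥ M) U := by
  classical
  refine ⟨⟨hG, fun b hb c hc => Gam_mul_comm hb hc⟩, fun C ⟨hCU, hC⟩ hGC X hX => ?_⟩
  have hone : ∀ μ : M, X.coeff μ ≠ 0 → μ = 1 := by
    intro μ hμ
    refine Subtype.ext (RingEquiv.ext fun a => ?_)
    have h := hC _ hX _ (hGC (ofDomain_mem_Gam_bot a))
    have h' := congrArg (coeffHom μ) h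
    rw [coeffHom_apply, coeffHom_apply, coeff_mul_ofDomain, coeff_ofDomain_mul, mul_comm] at h'
    exact IsFractionRing.injective Λ (FractionRing Λ) (mul_right_cancel₀ hμ h')
  obtain ⟨a, ha⟩ := mem_integralSubring.1 (hU (hCU hX)) 1
  have : X = ofDomain M a := by
    refine SkewMonoidAlgebra.ext fun μ => ?_
    rw [ofDomain_apply, SkewMonoidAlgebra.coeff_single_apply, ha]
    split_ifs with h
    · rw [h]
    · by_contra hμ
      exact h (hone μ hμ).symm
  rw [this]
  exact ofDomain_mem_Gam_bot a

end General
/-! ### The algebra `A(gl_2)` -/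

/-- The alternating groups on one and on two letters are trivial. -/
theorem altProd_two : altProd 2 = ⊥ := by
  have h : (Subgroup.pi Set.univ fun k : Fin 2 => alternatingGroup (Fin (k.1 + 1))) = ⊥ := by
    refine (Subgroup.eq_bot_iff_forall _).2 fun σ hσ => funext fun k => ?_
    have hk : σ k ∈ alternatingGroup (Fin (k.1 + 1)) := hσ k (Set.mem_univ k)
    have hn : Nat.card (alternatingGroup (Fin (k.1 + 1))) = 1 := by
      fin_cases k
      · exact Nat.card_unique (α := alternatingGroup (Fin 1))
      · exact (nat_card_alternatingGroup (α := Fin 2)).trans (by simp)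
    rw [Subgroup.eq_bot_of_card_eq _ hn] at hk
    exact Subgroup.mem_bot.1 hk
  rw [altProd, h, Subgroup.map_bot]

theorem x_ne_x {n k i l j : ℕ} (hi : 1 ≤ i ∧ i ≤ k ∧ k ≤ n) (hj : 1 ≤ j ∧ j ≤ l ∧ l ≤ n)
    (h : k ≠ l) : x n k i ≠ x n l j := by
  rw [x, x, dif_pos hi, dif_pos hj]
  intro heq
  have h1 := congrArg (fun p : Idx n => p.1.1) (MvPolynomial.X_injective heq)
  simp only at h1
  omega

theorem aPos_two : aPos 2 1 1 =
    algebraMap (Lam 2) (FractionRing (Lam 2))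
      (-((x 2 2 1 - x 2 1 1) * (x 2 2 2 - x 2 1 1))) := by
  rw [aPos, Finset.prod_Icc_succ_top (by omega)]
  simp [xL]

theorem aNeg_two : aNeg 2 1 1 = 1 := by
  simp [aNeg]

/-- For `n = 2` the denominator of `a_11^+` is empty, so that `X_1^+` has its coefficient in `Λ`. -/
theorem XPos_two (hk : 1 < 2) : XPos 2 hk = SkewMonoidAlgebra.single (deltaPos 2 hk 0)
    (algebraMap (Lam 2) (FractionRing (Lam 2)) (delta 2 1 1
      (-((x 2 2 1 - x 2 1 1) * (x 2 2 2 - x 2 1 1))))) := by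
  rw [XPos, Fin.sum_univ_one, ← smul_algebraMap_frac, ← aPos_two, ofFrac_apply,
    SkewMonoidAlgebra.single_mul_single, one_mul, mul_one]
  rfl

theorem XNeg_two (hk : 1 < 2) : XNeg 2 hk = SkewMonoidAlgebra.single (deltaNeg 2 hk 0) 1 := by
  have h : aNeg 2 1 ((0 : Fin 1).1 + 1) = 1 := aNeg_two
  rw [XNeg, Fin.sum_univ_one, h, map_one, mul_one]

theorem Un_le_Agl (n : ℕ) : Un n ≤ Agl n := fun _ h =>
  Subring.subset_closure (Or.inl h)

theorem XPos_mem_Agl (n : ℕ) {k : ℕ} (h1 : 1 ≤ k) (hk : k < n) : XPos n hk ∈ Agl n :=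
  Un_le_Agl n (Subring.subset_closure (Or.inl (Or.inr ⟨k, h1, hk, Or.inl rfl⟩)))

theorem XNeg_mem_Agl (n : ℕ) {k : ℕ} (h1 : 1 ≤ k) (hk : k < n) : XNeg n hk ∈ Agl n :=
  Un_le_Agl n (Subring.subset_closure (Or.inl (Or.inr ⟨k, h1, hk, Or.inr rfl⟩)))

theorem XDiag_mem_Agl (n : ℕ) {k : ℕ} (h1 : 1 ≤ k) (hk : k ≤ n) :
    ofDomain (shifts n) (XDiag n k) ∈ Agl n :=
  Un_le_Agl n (Subring.subset_closure (Or.inr ⟨k, h1, hk, rfl⟩))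

theorem C_mem_Agl (n : ℕ) (c : ℂ) : ofDomain (shifts n) (MvPolynomial.C c) ∈ Agl n :=
  Un_le_Agl n (Subring.subset_closure (Or.inl (Or.inl ⟨c, rfl⟩)))

theorem vandermonde_mem_Agl (n : ℕ) {k : ℕ} (h2 : 2 ≤ k) (hk : k ≤ n) :
    ofDomain (shifts n) (vandermonde n k) ∈ Agl n :=
  Subring.subset_closure (Or.inr ⟨k, h2, hk, rfl⟩)

/-- `x_11 = X_11`, while `x_21 + x_22 = X_22 + X_11 - 1` and `x_21 - x_22 = 𝒱_2`. Since `2` is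
invertible, all of `Λ` lies in `A(gl_2)`. -/
theorem ofDomain_mem_Agl_two (p : Lam 2) : ofDomain (shifts 2) p ∈ Agl 2 := by
  have hD1 : XDiag 2 1 = x 2 1 1 := by simp [XDiag]
  have hD2 : XDiag 2 2 = x 2 2 1 + x 2 2 2 + 1 - x 2 1 1 := by
    rw [XDiag, Finset.sum_Icc_succ_top (by omega)]
    simp
    ring
  have hV : vandermonde 2 2 = x 2 2 1 - x 2 2 2 := by
    have h : Finset.Ioc 1 2 = {2} := rfl
    rw [vandermonde, Finset.prod_Icc_succ_top (by omega)]
    simp [h]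
  let B : Subring (Lam 2) := (Agl 2).comap (ofDomain (shifts 2))
  have hC (c : ℂ) : MvPolynomial.C c ∈ B := C_mem_Agl 2 c
  have h11 : x 2 1 1 ∈ B := hD1 ▸ XDiag_mem_Agl 2 le_rfl (by omega)
  have hs : x 2 2 1 + x 2 2 2 + 1 - x 2 1 1 ∈ B := hD2 ▸ XDiag_mem_Agl 2 (by omega) le_rfl
  have hd : x 2 2 1 - x 2 2 2 ∈ B := hV ▸ vandermonde_mem_Agl 2 le_rfl le_rfl
  have hhalf : (MvPolynomial.C (1 / 2 : ℂ) : Lam 2) * 2 = 1 := by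
    rw [← map_ofNat (MvPolynomial.C (σ := Idx 2) (R := ℂ)) 2, ← map_mul]
    norm_num
  have h21 : x 2 2 1 ∈ B := by
    have : x 2 2 1 = MvPolynomial.C (1 / 2 : ℂ) *
        ((x 2 2 1 + x 2 2 2 + 1 - x 2 1 1) + x 2 1 1 - 1 + (x 2 2 1 - x 2 2 2)) := by
      linear_combination -x 2 2 1 * hhalf
    rw [this]
    exact mul_mem (hC _) (add_mem (sub_mem (add_mem hs h11) (one_mem _)) hd)
  have h22 : x 2 2 2 ∈ B := by
    rw [← sub_sub_cancel (x 2 2 1) (x 2 2 2)]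
    exact sub_mem h21 hd
  change p ∈ B
  induction p using MvPolynomial.induction_on with
  | C c => exact hC c
  | add p q hp hq => exact add_mem hp hq
  | mul_X p q hp =>
    refine mul_mem hp ?_
    obtain ⟨k, i⟩ := q
    fin_cases k
    · obtain rfl : i = ⟨0, by simp⟩ := Subsingleton.elim (α := Fin 1) _ _
      exact h11
    · change Fin 2 at i
      fin_cases i
      exacts [h21, h22]

theorem Gam_bot_le_Agl_two : Gam ⊥ (shifts 2) ≤ Agl 2 := by
  rintro _ ⟨p, -, rfl⟩
  exact ofDomain_mem_Agl_two p

/-- `A(gl_2)` is generated over `Λ` by `X_1^+` and `X_1^-`. -/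
theorem Agl_two_eq_closure : Agl 2 = Subring.closure
    ((Gam ⊥ (shifts 2) : Set (SkewRing (shifts 2))) ∪
      {XPos 2 one_lt_two, XNeg 2 one_lt_two}) := by
  refine le_antisymm ?_ (Subring.closure_le.2 (Set.union_subset Gam_bot_le_Agl_two ?_))
  · have hΛ (p : Lam 2) := Subring.subset_closure (s := (Gam ⊥ (shifts 2) :
      Set (SkewRing (shifts 2))) ∪ {XPos 2 one_lt_two, XNeg 2 one_lt_two})
      (Or.inl (ofDomain_mem_Gam_bot p))
    refine Subring.closure_le.2 (Set.union_subset (Subring.closure_le.2 ?_) ?_)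
    · rintro _ ((⟨c, rfl⟩ | ⟨k, h1, hk, h⟩) | ⟨k, -, -, rfl⟩)
      · exact hΛ _
      · obtain rfl : k = 1 := by omega
        exact Subring.subset_closure (Or.inr h)
      · exact hΛ _
    · rintro _ ⟨k, -, -, rfl⟩
      exact hΛ _
  · rintro _ (rfl | rfl)
    exacts [XPos_mem_Agl 2 le_rfl _, XNeg_mem_Agl 2 le_rfl _]

theorem Agl_two_le_integralSubring : Agl 2 ≤ integralSubring (shifts 2) := by
  rw [Agl_two_eq_closure]
  refine Subring.closure_le.2 (Set.union_subset ?_ ?_)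
  · rintro _ ⟨p, -, rfl⟩
    exact ofDomain_mem_integralSubring p
  · rintro _ (rfl | rfl)
    · rw [XPos_two]
      exact single_mem_integralSubring _ _
    · rw [XNeg_two, ← map_one (algebraMap (Lam 2) (FractionRing (Lam 2)))]
      exact single_mem_integralSubring _ _

/-- The `μ` with a nonzero multiple in `A(gl_2)` are closed under multiplication, and `δ`, `δ⁻¹` are
among them by `XPos_two` and `XNeg_two`. -/
theorem exists_single_mem_Agl_two (μ : shifts 2) :
    ∃ p ≠ 0, SkewMonoidAlgebra.single μ p ∈ Agl 2 := by
  obtain ⟨μ, hμ⟩ := μ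
  induction hμ using Subgroup.closure_induction'' with
  | mem d hd =>
    obtain ⟨k, i, h1, h2, h3, rfl⟩ := hd
    obtain rfl : i = 1 := by omega
    obtain rfl : k = 1 := by omega
    refine ⟨_, ?_, XPos_two one_lt_two ▸ XPos_mem_Agl 2 le_rfl one_lt_two⟩
    rw [Ne, FaithfulSMul.algebraMap_eq_zero_iff, EmbeddingLike.map_eq_zero_iff]
    exact neg_ne_zero.2 (mul_ne_zero
      (sub_ne_zero.2 (x_ne_x (by omega) (by omega) (by omega)))
      (sub_ne_zero.2 (x_ne_x (by omega) (by omega) (by omega))))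
  | inv_mem d hd =>
    obtain ⟨k, i, h1, h2, h3, rfl⟩ := hd
    obtain rfl : i = 1 := by omega
    obtain rfl : k = 1 := by omega
    exact ⟨1, one_ne_zero, XNeg_two one_lt_two ▸ XNeg_mem_Agl 2 le_rfl one_lt_two⟩
  | one => exact ⟨1, one_ne_zero, one_mem (Agl 2)⟩
  | mul μ ν hμ hν ihμ ihν =>
    obtain ⟨p, hp, hpU⟩ := ihμ
    obtain ⟨q, hq, hqU⟩ := ihν
    have h := mul_mem hpU hqU
    rw [SkewMonoidAlgebra.single_mul_single] at h
    exact ⟨_, mul_ne_zero hp ((smul_ne_zero_iff_ne (μ : RingAut (Lam 2))).2 hq), h⟩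

theorem isGaloisRing_Agl_two : IsGaloisRing ⊥ (shifts 2) (Agl 2) where
  assumptions := assumptions_bot
  base_le := Gam_bot_le_Agl_two
  le_invariants := by
    rw [invariants_bot]
    exact Set.subset_univ _
  finitelyGenerated := by
    classical
    exact ⟨{XPos 2 one_lt_two, XNeg 2 one_lt_two}, by
      rw [Finset.coe_pair]
      exact Agl_two_eq_closure⟩
  left_span := by rw [left_span_eq_univ exists_single_mem_Agl_two, invariants_bot]
  right_span := by rw [right_span_eq_univ exists_single_mem_Agl_two, invariants_bot]

end GaloisOrders

end

theorem theorem3p4 :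
    GaloisOrders.IsGaloisOrder (GaloisOrders.altProd 2) (GaloisOrders.shifts 2)
        (GaloisOrders.Agl 2) ∧
      GaloisOrders.IsHarishChandra (GaloisOrders.GamTilde 2) (GaloisOrders.Agl 2) ∧
      GaloisOrders.IsMaximalCommutative (GaloisOrders.GamTilde 2) (GaloisOrders.Agl 2) := by
  rw [GaloisOrders.GamTilde, GaloisOrders.altProd_two]
  have := GaloisOrders.isGaloisRing_Agl_two.assumptions.finiteness
  exact ⟨GaloisOrders.isGaloisRing_Agl_two.isGaloisOrder GaloisOrders.Agl_two_le_integralSubring,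
    GaloisOrders.isHarishChandra_of_le_integralSubring GaloisOrders.Gam_bot_le_Agl_two
      GaloisOrders.Agl_two_le_integralSubring,
    GaloisOrders.isMaximalCommutative_Gam_bot GaloisOrders.Gam_bot_le_Agl_two
      GaloisOrders.Agl_two_le_integralSubring⟩
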